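/- For $\alpha\in\mathbb R$ let $D_\alpha$ be the space of analytic functions $f(z)=\sum_{k\ge 0}a_kz^k$ on the open unit disk $\mathbb D$ with $\|f\|_\alpha^2=\sum_{k\ge0}(k+1)^\alpha|a_k|^2<\infty$, with inner product $\langle f,g\rangle_\alpha=\sum_{k\ge0}(k+1)^\alpha a_k\overline{b_k}$ for $g(z)=\sum_{k\ge 0} b_kz^k$; $D_{-1}$ is the Bergman space. A function $f\in D_\alpha$ is cyclic if the closed linear span of $\{z^kf:k\ge0\}$ is $D_\alpha$. An optimal approximant of order $n$ to $1/f$ in $D_\alpha$ is a polynomial $p$ of degree at most $n$ that minimizes $\|pf-1\|_\alpha$ among all polynomials of degree at most $n$. Let $f(z)=(1+z)/(1-z)^{4/5}$, with the principal branch of the power. Then $f$ belongs to the Bergman space $D_{-1}$ and is cyclic there; $zf\in D_{-1}$, and $$\|zf\|_{-1}^2=\frac{2142}{125}\,\frac{\Gamma(2/5)}{\Gamma(16/5)^2},\qquad \langle f,zf\rangle_{-1}=9\,\frac{\Gamma(7/5)}{\Gamma(11/5)^2}.$$ There is exactly one optimal approximant $p_1$ of order $1$ to $1/f$ in $D_{-1}$,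 and its zero set in $\mathbb C$ is $$\{z\in\mathbb C: p_1(z)=0\}=\left\{\tfrac{119}{121}\right\}.$$ In particular $p_1$ vanishes at the point $119/121$ of the open unit disk, where $f$ does not vanish, so that this zero is extraneous. -/

import Mathlib

open scoped Nat ComplexConjugate

noncomputable section

namespace DirichletType

/-- The `k`-th Taylor coefficient of `f` at the origin. -/
def coeff (f : ℂ → ℂ) (k : ℕ) : ℂ := iteratedDeriv k f 0 / (k ! : ℂ)

/-- The Dirichlet-type space `D_α`: functions that are analytic on the open unit disk and whose
Taylor coefficients satisfy `∑ (k + 1) ^ α * |a_k| ^ 2 < ∞`. Only the values on the disk matter;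
`α = -1` gives the Bergman space. -/
def space (α : ℝ) : Set (ℂ → ℂ) :=
  {f | DifferentiableOn ℂ f (Metric.ball 0 1) ∧
    Summable fun k : ℕ => ((k : ℝ) + 1) ^ α * ‖coeff f k‖ ^ 2}

/-- The norm of `D_α`, meaningful for members of `D_α`. -/
def dnorm (α : ℝ) (f : ℂ → ℂ) : ℝ :=
  √(∑' k : ℕ, ((k : ℝ) + 1) ^ α * ‖coeff f k‖ ^ 2)

/-- The inner product of `D_α`, linear in the first argument, meaningful for members of `D_α`. -/
def dinner (α : ℝ) (f g : ℂ → ℂ) : ℂ :=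
  ∑' k : ℕ, ((((k : ℝ) + 1) ^ α : ℝ) : ℂ) * coeff f k * conj (coeff g k)

/-- The closed subspace `[f]` of `D_α` generated by the functions `z ^ k * f`, `k = 0, 1, 2, …`:
the members of `D_α` that lie in the norm closure of their linear span. -/
def generated (α : ℝ) (f : ℂ → ℂ) : Set (ℂ → ℂ) :=
  {g | g ∈ space α ∧ ∀ ε : ℝ, 0 < ε →
    ∃ h ∈ Submodule.span ℂ (Set.range fun (k : ℕ) (z : ℂ) => z ^ k * f z),
      dnorm α (g - h) < ε}

/-- `f` is cyclic in `D_α`: `f ∈ D_α` and `[f] = D_α`. -/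
def IsCyclic (α : ℝ) (f : ℂ → ℂ) : Prop :=
  f ∈ space α ∧ generated α f = space α

/-- `p` is an optimal approximant of order `n` to `1 / f` in `D_α`: among all polynomials of degree
at most `n` it minimizes `‖p f - 1‖_α`. -/
def IsOptimalApproximant (α : ℝ) (f : ℂ → ℂ) (n : ℕ) (p : Polynomial ℂ) : Prop :=
  f ∈ space α ∧ p.natDegree ≤ n ∧ ∀ q : Polynomial ℂ, q.natDegree ≤ n →
    dnorm α (fun z => p.eval z * f z - 1) ≤ dnorm α (fun z => q.eval z * f z - 1)

/-- The function `(1 + z) / (1 - z) ^ (4 / 5)`, with the principal branch of the power (on the unit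
disk `1 - z` lies in the right half-plane). -/
def bergmanExample (z : ℂ) : ℂ := (1 + z) / (1 - z) ^ (4 / 5 : ℂ)

end DirichletType

end

open scoped Nat ComplexConjugate

noncomputable section

namespace DirichletType

open Filter Topology

/-! ### Generalised binomial coefficients -/

/-! The normalised Taylor coefficients `a_k / √(k + 1)` embed the Bergman space isometrically into
`ℓ²` (`toSeq`), so every question becomes Hilbert space geometry.

Zero of `p₁`: if `a + b z` is optimal, then `(a + b z) f - 1` is orthogonal to `f` and `z f`. Since
`⟨1, z f⟩ = 0`, the second equation reads `a ⟨f, z f⟩ + b ‖z f‖² = 0`, and the zero is `-a / b = ‖z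
f‖² / ⟨f, z f⟩` (`exists_unique_optimalApproximant`).

The two numbers: with `β_k` the coefficients of `(1 - z)^(-4/5)`, both series are rational multiples
of `S = ∑ β_k² / (k + 1) = ₂F₁(4/5, 4/5; 2; 1)`, up to a telescoping series with sum zero
(`tsum_eq_of_telescoping`). The multiples are `595/242` and `5/2`, with quotient `119/121`. Gauss's
theorem (`tsum_binom_sq_div`) evaluates `S`.

Cyclicity: `(1 - z)^(4/5)` has absolutely summable coefficients and multiplication by `z` is a
contraction, so `1 + z = (1 - z)^(4/5) f` lies in `[f]`. Then `1 - (-z)^j`, a multiple of `1 + z`,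
lies in `[f]` and tends to `1`; polynomials are dense. -/

theorem multichoose_succ {K : Type*} [Field K] [CharZero K] (a : K) (k : ℕ) :
    Ring.multichoose a (k + 1) = Ring.multichoose a k * (a + k) / (k + 1) := by
  have h1 := Ring.factorial_nsmul_multichoose_eq_ascPochhammer a (k + 1)
  have h0 := Ring.factorial_nsmul_multichoose_eq_ascPochhammer a k
  rw [Polynomial.ascPochhammer_smeval_eq_eval] at h0 h1
  rw [ascPochhammer_succ_eval, ← h0, Nat.factorial_succ] at h1
  simp only [nsmul_eq_mul, Nat.cast_mul, Nat.cast_add, Nat.cast_one] at h1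
  have hk : (k ! : K) ≠ 0 := by exact_mod_cast k.factorial_ne_zero
  have hk' : (k + 1 : K) ≠ 0 := by exact_mod_cast k.succ_ne_zero
  field_simp
  apply mul_left_cancel₀ hk
  linear_combination h1

theorem ofReal_multichoose (a : ℝ) (k : ℕ) :
    ((Ring.multichoose a k : ℝ) : ℂ) = Ring.multichoose (a : ℂ) k := by
  induction k with
  | zero => simp
  | succ k ih => rw [multichoose_succ, multichoose_succ, ← ih]; push_cast; rfl

/-! ### Taylor coefficients -/

theorem coeff_eq_of_hasFPowerSeriesAt {f : ℂ → ℂ} {c : ℕ → ℂ}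
    (h : HasFPowerSeriesAt f (.ofScalars ℂ c) 0) (k : ℕ) : coeff f k = c k := by
  have := congrArg (fun p => FormalMultilinearSeries.coeff p k)
    (h.analyticAt.hasFPowerSeriesAt.eq_formalMultilinearSeries h)
  simpa [FormalMultilinearSeries.coeff_ofScalars, coeff] using this

theorem coeff_add {f g : ℂ → ℂ} (hf : AnalyticAt ℂ f 0) (hg : AnalyticAt ℂ g 0) (k : ℕ) :
    coeff (f + g) k = coeff f k + coeff g k := by
  simp only [coeff, iteratedDeriv_add hf.contDiffAt hg.contDiffAt, add_div]

theorem coeff_smul (a : ℂ) (f : ℂ → ℂ) (k : ℕ) :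
    coeff (a • f) k = a * coeff f k := by
  simp only [coeff, iteratedDeriv_const_smul_field, smul_eq_mul, mul_div_assoc]

theorem coeff_mul {f g : ℂ → ℂ} (hf : AnalyticAt ℂ f 0) (hg : AnalyticAt ℂ g 0) (n : ℕ) :
    coeff (fun z => f z * g z) n = ∑ i ∈ Finset.range (n + 1), coeff f i * coeff g (n - i) := by
  simp only [coeff]
  rw [iteratedDeriv_fun_mul hf.contDiffAt hg.contDiffAt, Finset.sum_div]
  refine Finset.sum_congr rfl fun i hi => ?_
  have hi : i ≤ n := by simpa [Nat.lt_succ_iff] using hi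
  rw [Nat.cast_choose ℂ hi]
  have h1 : (i ! : ℂ) ≠ 0 := by exact_mod_cast i.factorial_ne_zero
  have h2 : ((n - i)! : ℂ) ≠ 0 := by exact_mod_cast (n - i).factorial_ne_zero
  have h3 : (n ! : ℂ) ≠ 0 := by exact_mod_cast n.factorial_ne_zero
  field_simp

theorem coeff_pow (j k : ℕ) : coeff (fun z => z ^ j) k = if k = j then 1 else 0 := by
  rw [coeff, iteratedDeriv_fun_pow_zero]
  have h : (k ! : ℂ) ≠ 0 := by exact_mod_cast k.factorial_ne_zero
  split_ifs with hk <;> simp_all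

theorem coeff_pow_mul (j : ℕ) {f : ℂ → ℂ} (hf : AnalyticAt ℂ f 0) (k : ℕ) :
    coeff (fun z => z ^ j * f z) k = if j ≤ k then coeff f (k - j) else 0 := by
  rw [coeff_mul (by fun_prop) hf]
  simp [coeff_pow]

theorem coeff_mul_id_zero {f : ℂ → ℂ} (hf : AnalyticAt ℂ f 0) :
    coeff (fun z => z * f z) 0 = 0 := by
  simpa using coeff_pow_mul 1 hf 0

theorem coeff_mul_id_succ {f : ℂ → ℂ} (hf : AnalyticAt ℂ f 0) (k : ℕ) :
    coeff (fun z => z * f z) (k + 1) = coeff f k := by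
  simpa using coeff_pow_mul 1 hf (k + 1)

theorem hasFPowerSeriesAt_one_sub_cpow (a : ℂ) :
    HasFPowerSeriesAt (fun z : ℂ => (1 - z) ^ (-a)) (.ofScalars ℂ (Ring.multichoose a)) 0 := by
  have h := (Complex.one_div_one_sub_cpow_hasFPowerSeriesOnBall_zero a).hasFPowerSeriesAt
  simp_rw [← Ring.multichoose_eq] at h
  simpa only [Complex.cpow_neg, one_div] using h

theorem coeff_one_sub_cpow (a : ℂ) (k : ℕ) :
    coeff (fun z : ℂ => (1 - z) ^ (-a)) k = Ring.multichoose a k :=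
  coeff_eq_of_hasFPowerSeriesAt (hasFPowerSeriesAt_one_sub_cpow a) k

theorem analyticAt_of_mem_space {α : ℝ} {f : ℂ → ℂ} (hf : f ∈ space α) : AnalyticAt ℂ f 0 :=
  hf.1.analyticAt (Metric.ball_mem_nhds 0 one_pos)

/-! ### The Bergman space inside `ℓ²` -/

/-- The Bergman space `D_{-1}` as a subspace of the space of all functions. -/
def bergman : Submodule ℂ (ℂ → ℂ) where
  carrier := space (-1)
  zero_mem' := ⟨differentiableOn_const 0, by
    have : ∀ k, coeff (0 : ℂ → ℂ) k = 0 := fun k => by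
      simpa using coeff_smul 0 0 k
    simp [this]⟩
  add_mem' {f g} hf hg := ⟨hf.1.add hg.1, by
    refine Summable.of_nonneg_of_le (fun k => by positivity) (fun k => ?_)
      ((hf.2.add hg.2).mul_left 2)
    rw [coeff_add (analyticAt_of_mem_space hf) (analyticAt_of_mem_space hg), ← mul_add,
      mul_left_comm]
    gcongr
    exact (pow_le_pow_left₀ (norm_nonneg _) (norm_add_le _ _) 2).trans add_sq_le⟩
  smul_mem' a f hf := ⟨hf.1.const_smul a, by
    refine (hf.2.mul_left (‖a‖ ^ 2)).congr fun k => ?_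
    rw [coeff_smul a f, norm_mul]
    ring⟩

theorem mem_bergman {f : ℂ → ℂ} : f ∈ bergman ↔ f ∈ space (-1) := Iff.rfl

theorem mem_bergman_iff {f : ℂ → ℂ} : f ∈ bergman ↔ DifferentiableOn ℂ f (Metric.ball 0 1) ∧
    Summable fun k : ℕ => ‖coeff f k‖ ^ 2 / (k + 1) := by
  simp only [mem_bergman, space, Set.mem_ofPred_eq, Real.rpow_neg_one, div_eq_inv_mul]

theorem analyticAt_of_mem_bergman {f : ℂ → ℂ} (hf : f ∈ bergman) : AnalyticAt ℂ f 0 :=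
  analyticAt_of_mem_space hf

theorem norm_coeff_div_sqrt_sq (f : ℂ → ℂ) (k : ℕ) :
    ‖coeff f k / (√(k + 1 : ℝ) : ℂ)‖ ^ 2 = ‖coeff f k‖ ^ 2 / (k + 1) := by
  rw [norm_div, div_pow, Complex.norm_real, Real.norm_eq_abs, sq_abs, Real.sq_sqrt (by positivity)]

/-- The isometry from the Bergman space to `ℓ²` sending `∑ a_k z^k` to `(a_k / √(k + 1))_k`. -/
def toSeq : bergman →ₗ[ℂ] lp (fun _ : ℕ => ℂ) 2 where
  toFun f := ⟨fun k => coeff f.1 k / (√(k + 1 : ℝ) : ℂ), by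
    refine memℓp_gen ?_
    have := (mem_bergman_iff.1 f.2).2
    simpa only [ENNReal.toReal_ofNat, Real.rpow_ofNat, norm_coeff_div_sqrt_sq] using this⟩
  map_add' f g := by
    ext k
    rw [lp.coeFn_add]
    simp [coeff_add (analyticAt_of_mem_bergman f.2) (analyticAt_of_mem_bergman g.2), add_div]
  map_smul' a f := by
    ext k
    simp [coeff_smul a f.1, mul_div_assoc]

theorem toSeq_apply (f : bergman) (k : ℕ) : toSeq f k = coeff f.1 k / (√(k + 1 : ℝ) : ℂ) := rfl

theorem norm_toSeq_sq (f : bergman) : ‖toSeq f‖ ^ 2 = ∑' k : ℕ, ‖coeff f.1 k‖ ^ 2 / (k + 1) := by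
  have h := lp.norm_rpow_eq_tsum (p := 2) (by simp) (toSeq f)
  simpa only [toSeq_apply, ENNReal.toReal_ofNat, Real.rpow_ofNat, norm_coeff_div_sqrt_sq] using h

theorem dnorm_eq_norm_toSeq (f : bergman) : dnorm (-1) f = ‖toSeq f‖ := by
  rw [dnorm, ← Real.sqrt_sq (norm_nonneg (toSeq f)), norm_toSeq_sq]
  simp only [Real.rpow_neg_one, div_eq_inv_mul]

/-- The arguments swap because `inner ℂ` is conjugate-linear in its first slot, while `dinner` is
linear there. -/
theorem dinner_eq_inner_toSeq (f g : bergman) :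
    dinner (-1) f g = inner ℂ (toSeq g) (toSeq f) := by
  rw [lp.inner_eq_tsum, dinner]
  refine tsum_congr fun k => ?_
  have h : (√(k + 1 : ℝ) : ℂ) * (√(k + 1 : ℝ) : ℂ) = k + 1 := by
    rw [← Complex.ofReal_mul, Real.mul_self_sqrt (by positivity)]; push_cast; rfl
  rw [toSeq_apply, toSeq_apply, RCLike.inner_apply, map_div₀, Complex.conj_ofReal,
    div_mul_div_comm, h, Real.rpow_neg_one]
  push_cast
  rw [mul_assoc, div_eq_inv_mul]

theorem summable_norm_coeff_sq_div_add_two {f : ℂ → ℂ} (hf : f ∈ bergman) :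
    Summable fun k : ℕ => ‖coeff f k‖ ^ 2 / (k + 2) :=
  Summable.of_nonneg_of_le (fun k => by positivity) (fun k => by gcongr; norm_num)
    (mem_bergman_iff.1 hf).2

theorem id_mul_mem_bergman {f : ℂ → ℂ} (hf : f ∈ bergman) : (fun z => z * f z) ∈ bergman := by
  refine mem_bergman_iff.2 ⟨differentiableOn_id.mul (mem_bergman_iff.1 hf).1, ?_⟩
  rw [← summable_nat_add_iff 1]
  refine (summable_norm_coeff_sq_div_add_two hf).congr fun k => ?_
  rw [coeff_mul_id_succ (analyticAt_of_mem_bergman hf)]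
  push_cast; ring

/-- Multiplication by the coordinate function. -/
def shift : bergman →ₗ[ℂ] bergman where
  toFun f := ⟨fun z => z * f.1 z, id_mul_mem_bergman f.2⟩
  map_add' f g := by ext z; simp [mul_add]
  map_smul' a f := by ext z; simp [mul_left_comm]

theorem shift_apply (f : bergman) (z : ℂ) : (shift f).1 z = z * f.1 z := rfl

/-- Multiplication by `z` moves `a_k` to degree `k + 1`, where the weight is `1 / (k + 2)`. As this
is at most `1 / (k + 1)`, the shift is a contraction. -/
theorem norm_toSeq_shift_sq (f : bergman) :
    ‖toSeq (shift f)‖ ^ 2 = ∑' k : ℕ, ‖coeff f.1 k‖ ^ 2 / (k + 2) := by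
  rw [norm_toSeq_sq, (mem_bergman_iff.1 (shift f).2).2.tsum_eq_zero_add]
  have h0 : coeff (shift f).1 0 = 0 := coeff_mul_id_zero (analyticAt_of_mem_bergman f.2)
  have h1 (k : ℕ) : coeff (shift f).1 (k + 1) = coeff f.1 k :=
    coeff_mul_id_succ (analyticAt_of_mem_bergman f.2) k
  rw [h0]
  simp only [h1]
  simp only [Nat.cast_add, Nat.cast_one, norm_zero, ne_eq, OfNat.ofNat_ne_zero, not_false_eq_true,
    zero_pow, zero_div, zero_add, add_assoc, one_add_one_eq_two]

theorem norm_toSeq_shift_le (f : bergman) : ‖toSeq (shift f)‖ ≤ ‖toSeq f‖ := by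
  rw [← sq_le_sq₀ (norm_nonneg _) (norm_nonneg _), norm_toSeq_shift_sq, norm_toSeq_sq]
  refine (summable_norm_coeff_sq_div_add_two f.2).tsum_le_tsum (fun k => ?_) (mem_bergman_iff.1 f.2).2
  gcongr
  norm_num

theorem shift_pow_apply (j : ℕ) (f : bergman) (z : ℂ) : ((shift ^ j) f).1 z = z ^ j * f.1 z := by
  induction j with
  | zero => simp
  | succ j ih => rw [pow_succ', Module.End.mul_apply, shift_apply, ih]; ring

theorem norm_toSeq_shift_pow_le (j : ℕ) (f : bergman) : ‖toSeq ((shift ^ j) f)‖ ≤ ‖toSeq f‖ := by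
  induction j with
  | zero => simp
  | succ j ih =>
    rw [pow_succ', Module.End.mul_apply]
    exact (norm_toSeq_shift_le _).trans ih

theorem coeff_shift_pow (j : ℕ) (f : bergman) (k : ℕ) :
    coeff ((shift ^ j) f).1 k = if j ≤ k then coeff f.1 (k - j) else 0 := by
  rw [← coeff_pow_mul j (analyticAt_of_mem_bergman f.2)]
  congr 1
  ext z
  exact shift_pow_apply j f z

/-! ### Sums of squares of generalised binomial coefficients -/

/-- The Taylor coefficients of `(1 - z) ^ (-4/5)`. -/
def binom (k : ℕ) : ℝ := Ring.multichoose (4 / 5 : ℝ) k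

theorem binom_zero : binom 0 = 1 := by simp [binom]

theorem binom_succ (k : ℕ) : binom (k + 1) = binom k * (k + 4 / 5) / (k + 1) := by
  rw [binom, multichoose_succ, binom, add_comm (4 / 5 : ℝ)]

theorem binom_pos (k : ℕ) : 0 < binom k := by
  induction k with
  | zero => simp [binom_zero]
  | succ k ih => rw [binom_succ]; positivity

/-- Bernoulli's inequality for the exponent `1/5` bounds the consecutive ratio `(k + 4/5) / (k +
1)`. The decay gives both the convergence of the series and the vanishing of telescoping boundary
terms. -/
theorem binom_le_rpow (k : ℕ) : binom k ≤ ((k : ℝ) + 1) ^ (-(1 / 5) : ℝ) := by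
  induction k with
  | zero => simp [binom_zero]
  | succ k ih =>
    have hk : (0 : ℝ) < k + 1 := by positivity
    have hb : (1 + 1 / (k + 1 : ℝ)) ^ (1 / 5 : ℝ) ≤ 1 + 1 / 5 * (1 / (k + 1)) :=
      rpow_one_add_le_one_add_mul_self ((by norm_num : (-1 : ℝ) ≤ 0).trans (by positivity))
        (by norm_num) (by norm_num)
    have hx : ((k + 1 : ℕ) : ℝ) + 1 = (k + 1) * (1 + 1 / (k + 1)) := by
      push_cast; field_simp
    rw [hx, Real.mul_rpow (by positivity) (by positivity), binom_succ, mul_div_assoc]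
    refine mul_le_mul ih ?_ (by positivity) (by positivity)
    rw [Real.rpow_neg (by positivity), le_inv_comm₀ (by positivity) (by positivity)]
    refine hb.trans ?_
    rw [inv_div, le_div_iff₀ (by positivity)]
    field_simp
    nlinarith

theorem binom_sq_le (k : ℕ) : binom k ^ 2 ≤ ((k : ℝ) + 1) ^ (-(2 / 5) : ℝ) := by
  have h := pow_le_pow_left₀ (binom_pos k).le (binom_le_rpow k) 2
  rwa [← Real.rpow_natCast, ← Real.rpow_natCast, ← Real.rpow_mul (by positivity),
    show (-(1 / 5) * ((2 : ℕ) : ℝ) : ℝ) = -(2 / 5) by norm_num, Real.rpow_natCast] at h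

theorem tendsto_binom_sq : Tendsto (fun k => binom k ^ 2) atTop (𝓝 0) := by
  refine squeeze_zero (fun k => sq_nonneg _) binom_sq_le ?_
  exact (tendsto_rpow_neg_atTop (by norm_num)).comp
    (tendsto_atTop_add_const_right _ 1 tendsto_natCast_atTop_atTop)

theorem summable_binom_sq_div : Summable fun k : ℕ => binom k ^ 2 / (k + 1) := by
  have h : Summable fun k : ℕ => ((k : ℝ) + 1) ^ (-(7 / 5) : ℝ) := by
    have := (summable_nat_add_iff 1).2 (Real.summable_nat_rpow (p := -(7 / 5)) |>.2 (by norm_num))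
    simpa using this
  refine Summable.of_nonneg_of_le (fun k => by positivity) (fun k => ?_) h
  rw [show (-(7 / 5) : ℝ) = -(2 / 5) - 1 by norm_num, Real.rpow_sub_one (by positivity)]
  gcongr
  exact binom_sq_le k

/-! ### Gauss's theorem from contiguous hypergeometric series -/

theorem tsum_forward_difference {v : ℕ → ℝ} (h0 : v 0 = 0) (hv : Tendsto v atTop (𝓝 0))
    (hs : Summable fun k => v (k + 1) - v k) : ∑' k, (v (k + 1) - v k) = 0 := by
  refine tendsto_nhds_unique hs.hasSum.tendsto_sum_nat ?_
  simpa only [Finset.sum_range_sub, h0, sub_zero] using hv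

/-- The terms of the hypergeometric series `₂F₁(4/5, 4/5; n + 2; 1)`. -/
def gaussTerm (n k : ℕ) : ℝ := binom k ^ 2 / (n + 1 + k).choose k

theorem gaussTerm_nonneg (n k : ℕ) : 0 ≤ gaussTerm n k := by unfold gaussTerm; positivity

theorem gaussTerm_zero_left (k : ℕ) : gaussTerm 0 k = binom k ^ 2 / (k + 1) := by
  rw [gaussTerm, zero_add, add_comm 1 k, Nat.choose_succ_self_right]; push_cast; rfl

theorem gaussTerm_zero_right (n : ℕ) : gaussTerm n 0 = 1 := by simp [gaussTerm, binom_zero]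

theorem gaussTerm_succ_right (n k : ℕ) :
    gaussTerm n (k + 1) = gaussTerm n k * (k + 4 / 5) ^ 2 / ((k + 1) * (n + 2 + k)) := by
  have h := Nat.add_one_mul_choose_eq (n + 1 + k) k
  have h' : ((n : ℝ) + 1 + k + 1) * (n + 1 + k).choose k =
      (n + 1 + (k + 1)).choose (k + 1) * (k + 1) := by exact_mod_cast h
  have hp : (0 : ℝ) < (n + 1 + k).choose k := by
    exact_mod_cast Nat.choose_pos (Nat.le_add_left _ _)
  have hq : ((n + 1 + (k + 1)).choose (k + 1) : ℝ) =
      (n + 1 + k + 1) * (n + 1 + k).choose k / (k + 1) := by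
    rw [h']; field_simp
  rw [gaussTerm, gaussTerm, hq, binom_succ]
  field_simp
  ring

theorem gaussTerm_succ_left (n k : ℕ) :
    gaussTerm (n + 1) k = gaussTerm n k * (n + 2) / (n + 2 + k) := by
  induction k with
  | zero => simp only [gaussTerm_zero_right]; field_simp; simp
  | succ k ih =>
    rw [gaussTerm_succ_right, gaussTerm_succ_right, ih]
    push_cast
    field_simp
    ring

theorem gaussTerm_le (n k : ℕ) : gaussTerm n k ≤ binom k ^ 2 / (k + 1) := by
  induction n with
  | zero => rw [gaussTerm_zero_left]
  | succ n ih =>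
    refine le_trans ?_ ih
    rw [gaussTerm_succ_left, mul_div_assoc]
    exact mul_le_of_le_one_right (gaussTerm_nonneg n k)
      (div_le_one_of_le₀ (by simp) (by positivity))

theorem summable_gaussTerm (n : ℕ) : Summable (gaussTerm n) :=
  Summable.of_nonneg_of_le (gaussTerm_nonneg n) (gaussTerm_le n) summable_binom_sq_div

/-- This is `c (c - a - b) F(c) = (c - a) (c - b) F(c + 1)` for `a = b = 4/5`, `c = n + 2`:
termwise, the two sides differ by a telescoping term. -/
theorem gauss_contiguous (n : ℕ) :
    (n + 2) * (n + 2 / 5) * ∑' k, gaussTerm n k = (n + 6 / 5) ^ 2 * ∑' k, gaussTerm (n + 1) k := by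
  have hs := ((summable_gaussTerm n).mul_left (((n : ℝ) + 2) * (n + 2 / 5))).sub
    ((summable_gaussTerm (n + 1)).mul_left (((n : ℝ) + 6 / 5) ^ 2))
  set v : ℕ → ℝ := fun k => -(n + 2) * (k * gaussTerm n k) with hv
  have hd (k : ℕ) : (n + 2) * (n + 2 / 5) * gaussTerm n k - (n + 6 / 5) ^ 2 * gaussTerm (n + 1) k
      = v (k + 1) - v k := by
    simp only [hv]
    rw [gaussTerm_succ_left, gaussTerm_succ_right]
    push_cast
    field_simp
    ring
  have hlim : Tendsto v atTop (𝓝 0) := by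
    have : Tendsto (fun k : ℕ => (k : ℝ) * gaussTerm n k) atTop (𝓝 0) := by
      refine squeeze_zero (fun k => mul_nonneg k.cast_nonneg (gaussTerm_nonneg n k))
        (fun k => ?_) tendsto_binom_sq
      calc (k : ℝ) * gaussTerm n k ≤ (k + 1) * (binom k ^ 2 / (k + 1)) :=
            mul_le_mul (by simp) (gaussTerm_le n k) (gaussTerm_nonneg n k) (by positivity)
        _ = binom k ^ 2 := by field_simp
    simpa [hv] using this.const_mul (-((n : ℝ) + 2))
  have h0 := tsum_forward_difference (v := v) (by simp [hv]) hlim (hs.congr hd)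
  rw [← tsum_congr hd, Summable.tsum_sub ((summable_gaussTerm n).mul_left _)
    ((summable_gaussTerm (n + 1)).mul_left _), tsum_mul_left, tsum_mul_left] at h0
  linarith

theorem tendsto_tsum_gaussTerm : Tendsto (fun n => ∑' k, gaussTerm n k) atTop (𝓝 1) := by
  -- As `n → ∞` the term with `k = 0` stays `1` and every other term is `O(1 / n)`; the series for
  -- `n = 0` dominates.
  have h1 : (1 : ℝ) = ∑' k : ℕ, if k = 0 then (1 : ℝ) else 0 := by simp
  rw [h1]
  refine tendsto_tsum_of_dominated_convergence (bound := fun k => binom k ^ 2 / (k + 1))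
    summable_binom_sq_div (fun k => ?_) (.of_forall fun n k => ?_)
  · rcases k with _ | k
    · simp [gaussTerm_zero_right]
    · simp only [Nat.add_eq_zero_iff, one_ne_zero, and_false, if_false]
      refine squeeze_zero (fun n => gaussTerm_nonneg n _)
        (g := fun n : ℕ => gaussTerm 0 k * (k + 4 / 5) ^ 2 * (1 / ((n : ℝ) + 1))) (fun n => ?_) ?_
      · have hle : gaussTerm n k ≤ gaussTerm 0 k := by
          rw [gaussTerm_zero_left]; exact gaussTerm_le n k
        have hden : (n : ℝ) + 1 ≤ (k + 1) * (n + 2 + k) := by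
          have hk : (0 : ℝ) ≤ k := k.cast_nonneg
          have hn : (0 : ℝ) ≤ n := n.cast_nonneg
          nlinarith [mul_nonneg hk hn]
        rw [gaussTerm_succ_right, div_eq_mul_one_div]
        exact mul_le_mul (mul_le_mul_of_nonneg_right hle (by positivity))
          (one_div_le_one_div_of_le (by positivity) hden) (by positivity)
          (mul_nonneg (gaussTerm_nonneg 0 k) (by positivity))
      · simpa only [mul_zero] using (tendsto_one_div_add_atTop_nhds_zero_nat (𝕜 := ℝ)).const_mul
          (gaussTerm 0 k * ((k : ℝ) + 4 / 5) ^ 2)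
  · rw [Real.norm_of_nonneg (gaussTerm_nonneg n k)]
    exact gaussTerm_le n k

theorem tsum_gaussTerm_eq_prod (n : ℕ) : ∑' k, gaussTerm 0 k =
    (∏ j ∈ Finset.range n, ((6 / 5 : ℝ) + j) ^ 2 / ((2 + j) * (2 / 5 + j))) *
      ∑' k, gaussTerm n k := by
  induction n with
  | zero => simp
  | succ n ih =>
    rw [ih, Finset.prod_range_succ]
    have h : ∑' k, gaussTerm n k =
        ((6 / 5 : ℝ) + n) ^ 2 / ((2 + n) * (2 / 5 + n)) * ∑' k, gaussTerm (n + 1) k := by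
      have := gauss_contiguous n
      field_simp
      linear_combination 5 * 5 * this
    rw [h, mul_assoc]

/-- Gauss's summation theorem for `₂F₁(4/5, 4/5; 2; 1)`. -/
theorem tsum_binom_sq_div : ∑' k : ℕ, binom k ^ 2 / (k + 1) =
    Real.Gamma (2 / 5) / Real.Gamma (6 / 5) ^ 2 := by
  have hseq : Tendsto (fun n => Real.GammaSeq 2 n * Real.GammaSeq (2 / 5) n /
      Real.GammaSeq (6 / 5) n ^ 2 * ∑' k, gaussTerm (n + 1) k) atTop
      (𝓝 (Real.Gamma 2 * Real.Gamma (2 / 5) / Real.Gamma (6 / 5) ^ 2 * 1)) :=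
    (((Real.GammaSeq_tendsto_Gamma 2).mul (Real.GammaSeq_tendsto_Gamma _)).div
      ((Real.GammaSeq_tendsto_Gamma _).pow 2)
      (pow_ne_zero 2 (Real.Gamma_pos_of_pos (by norm_num)).ne')).mul
      (tendsto_tsum_gaussTerm.comp (tendsto_add_atTop_nat 1))
  have hconst : ∀ᶠ n in atTop, Real.GammaSeq 2 n * Real.GammaSeq (2 / 5) n /
      Real.GammaSeq (6 / 5) n ^ 2 * ∑' k, gaussTerm (n + 1) k = ∑' k, gaussTerm 0 k := by
    filter_upwards [eventually_gt_atTop 0] with n hn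
    -- `GammaSeq s n` has the `n + 1` factors `s + j`, `j = 0, …, n`, hence `n + 1` contiguity
    -- steps.
    rw [tsum_gaussTerm_eq_prod (n + 1)]
    congr 1
    simp only [Real.GammaSeq, Finset.prod_div_distrib, Finset.prod_mul_distrib, Finset.prod_pow]
    have hp (s : ℝ) (hs : 0 < s) : ∏ j ∈ Finset.range (n + 1), (s + j) ≠ 0 :=
      Finset.prod_ne_zero_iff.2 fun j _ => by positivity
    have h2 := hp 2 (by norm_num)
    have h25 := hp (2 / 5) (by norm_num)
    have h65 := hp (6 / 5) (by norm_num)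
    have hn0 : (0 : ℝ) < n := by exact_mod_cast hn
    -- The powers of `n` cancel because `2 + 2/5 = 2 · 6/5`.
    have hpow : (n : ℝ) ^ (2 : ℝ) * (n : ℝ) ^ (2 / 5 : ℝ) = ((n : ℝ) ^ (6 / 5 : ℝ)) ^ 2 := by
      rw [← Real.rpow_add hn0, ← Real.rpow_natCast, ← Real.rpow_mul hn0.le]
      norm_num
    have hf : (n ! : ℝ) ≠ 0 := by exact_mod_cast n.factorial_ne_zero
    have hq : (n : ℝ) ^ (6 / 5 : ℝ) ≠ 0 := (Real.rpow_pos_of_pos hn0 _).ne'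
    generalize ∏ j ∈ Finset.range (n + 1), ((2 : ℝ) + j) = A at *
    generalize ∏ j ∈ Finset.range (n + 1), ((2 / 5 : ℝ) + j) = B at *
    generalize ∏ j ∈ Finset.range (n + 1), ((6 / 5 : ℝ) + j) = C at *
    generalize (n : ℝ) ^ (2 : ℝ) = X at *
    generalize (n : ℝ) ^ (2 / 5 : ℝ) = Y at *
    generalize (n : ℝ) ^ (6 / 5 : ℝ) = Z at *
    field_simp
    linear_combination hpow
  have := tendsto_nhds_unique (hseq.congr' hconst) tendsto_const_nhds
  simp only [← gaussTerm_zero_left]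
  rw [← this, Real.Gamma_two, one_mul, mul_one]

theorem five_mul_sub_one_ne_zero (k : ℕ) : (5 * k - 1 : ℝ) ≠ 0 := by
  intro h
  have h' : (5 * k : ℝ) = 1 := by linarith
  have : 5 * k = 1 := by exact_mod_cast h'
  omega

/-- If `t k` differs from `l * (binom k ^ 2 / (k + 1))` by a telescoping term that tends to zero,
then `∑ t k` is `l` times the value given by Gauss's theorem. -/
theorem tsum_eq_of_telescoping {t R : ℕ → ℝ} {l C : ℝ} (ht : Summable t) (h0 : R 0 = 0)
    (hR : ∀ k, |R k| ≤ C)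
    (h : ∀ k, t k - l * (binom k ^ 2 / (k + 1)) =
      R (k + 1) * binom (k + 1) ^ 2 - R k * binom k ^ 2) :
    ∑' k, t k = l * (Real.Gamma (2 / 5) / Real.Gamma (6 / 5) ^ 2) := by
  have hs := ht.sub (summable_binom_sq_div.mul_left l)
  have hlim : Tendsto (fun k => R k * binom k ^ 2) atTop (𝓝 0) := by
    refine squeeze_zero_norm (a := fun k => C * binom k ^ 2) (fun k => ?_)
      (by simpa using tendsto_binom_sq.const_mul C)
    rw [norm_mul, Real.norm_eq_abs, Real.norm_of_nonneg (sq_nonneg _)]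
    gcongr
    exact hR k
  have := tsum_forward_difference (v := fun k => R k * binom k ^ 2) (by simp [h0]) hlim
    (hs.congr h)
  rw [← tsum_congr h, ht.tsum_sub (summable_binom_sq_div.mul_left l), tsum_mul_left,
    tsum_binom_sq_div] at this
  linarith

/-- The Taylor coefficients of `(1 + z) / (1 - z) ^ (4 / 5)`. -/
def exampleCoeff (k : ℕ) : ℝ := binom k * (10 * k - 1) / (5 * k - 1)

theorem exampleCoeff_succ (k : ℕ) :
    exampleCoeff (k + 1) = binom k * (10 * k + 9) / (5 * (k + 1)) := by
  have : (5 * ((k + 1 : ℕ) : ℝ) - 1) = 5 * (k + 4 / 5) := by push_cast; ring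
  rw [exampleCoeff, binom_succ, this]
  push_cast
  field_simp
  ring

theorem exampleCoeff_zero : exampleCoeff 0 = 1 := by simp [exampleCoeff, binom_zero]

theorem exampleCoeff_succ_eq_add (k : ℕ) : exampleCoeff (k + 1) = binom (k + 1) + binom k := by
  rw [exampleCoeff_succ, binom_succ]
  field_simp
  ring

theorem exampleCoeff_nonneg (k : ℕ) : 0 ≤ exampleCoeff k := by
  rcases k with _ | k
  · simp [exampleCoeff_zero]
  · rw [exampleCoeff_succ_eq_add]
    exact (add_pos (binom_pos _) (binom_pos _)).le

theorem exampleCoeff_sq_le (k : ℕ) : exampleCoeff k ^ 2 ≤ 16 * binom k ^ 2 := by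
  have h : exampleCoeff k ≤ 4 * binom k := by
    rcases k with _ | k
    · simp [exampleCoeff_zero, binom_zero]
    · have := binom_pos k
      rw [exampleCoeff_succ_eq_add, binom_succ]
      field_simp
      nlinarith [(k.cast_nonneg : (0 : ℝ) ≤ k)]
  nlinarith [exampleCoeff_nonneg k, binom_pos k]

theorem summable_exampleCoeff_sq_div : Summable fun k : ℕ => exampleCoeff k ^ 2 / (k + 1) := by
  refine Summable.of_nonneg_of_le (fun k => by positivity) (fun k => ?_)
    (summable_binom_sq_div.mul_left 16)
  rw [← mul_div_assoc]
  gcongr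
  exact exampleCoeff_sq_le k

theorem tsum_exampleCoeff_sq_div : ∑' k : ℕ, exampleCoeff k ^ 2 / (k + 2) =
    595 / 242 * (Real.Gamma (2 / 5) / Real.Gamma (6 / 5) ^ 2) := by
  -- `R` is a Gosper-type rational certificate. Its numerator is divisible by `k`, so `R 0 = 0`;
  -- numerator and denominator both have degree 3, so `R` is bounded, and `10` is a crude bound.
  refine tsum_eq_of_telescoping (C := 10)
    (R := fun k => (875 / 484 * k - 75 / 22 * k ^ 2 - 46625 / 484 * k ^ 3) /
      ((5 * k - 1) ^ 2 * (k + 1))) ?_ (by simp) (fun k => ?_) (fun k => ?_)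
  · refine Summable.of_nonneg_of_le (fun k => by positivity) (fun k => ?_)
      summable_exampleCoeff_sq_div
    gcongr
    norm_num
  · have h5 := five_mul_sub_one_ne_zero k
    rw [abs_div, abs_of_pos (a := (5 * (k : ℝ) - 1) ^ 2 * (k + 1)) (by positivity),
      div_le_iff₀ (by positivity)]
    rcases k with _ | k
    · norm_num
    · push_cast
      have hk : (0 : ℝ) ≤ k := k.cast_nonneg
      rw [abs_le]
      constructor <;> nlinarith [pow_nonneg hk 2, pow_nonneg hk 3]
  · have h5 := five_mul_sub_one_ne_zero k
    have h6 : 5 * ((k : ℝ) + 1) - 1 = 5 * k + 4 := by ring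
    rw [exampleCoeff, binom_succ]
    simp only [Nat.cast_add, Nat.cast_one, h6]
    -- `5 k - 1` is negative at `k = 0`, so only its being nonzero is available; it becomes the
    -- variable of the polynomial identity.
    generalize hD : 5 * (k : ℝ) - 1 = D at h5
    have hk : (k : ℝ) = (D + 1) / 5 := by linarith
    field_simp
    rw [hk]
    ring

theorem summable_exampleCoeff_mul_div :
    Summable fun k : ℕ => exampleCoeff (k + 1) * exampleCoeff k / (k + 2) := by
  have h1 := summable_exampleCoeff_sq_div
  have h2 := (summable_nat_add_iff 1).2 h1
  refine Summable.of_nonneg_of_le (fun k => ?_) (fun k => ?_) (h1.add h2)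
  · have := exampleCoeff_nonneg k
    have := exampleCoeff_nonneg (k + 1)
    positivity
  · have hle : exampleCoeff k ^ 2 / (k + 2) ≤ exampleCoeff k ^ 2 / (k + 1) := by
      gcongr; norm_num
    refine le_trans ?_ (add_le_add_left hle _)
    have h3 : ((k + 1 : ℕ) : ℝ) + 1 = k + 2 := by push_cast; ring
    rw [h3, ← add_div]
    gcongr
    nlinarith [sq_nonneg (exampleCoeff (k + 1) - exampleCoeff k), sq_nonneg (exampleCoeff k),
      sq_nonneg (exampleCoeff (k + 1))]

theorem tsum_exampleCoeff_mul_div : ∑' k : ℕ, exampleCoeff (k + 1) * exampleCoeff k / (k + 2) =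
    5 / 2 * (Real.Gamma (2 / 5) / Real.Gamma (6 / 5) ^ 2) := by
  refine tsum_eq_of_telescoping (C := 10)
    (R := fun k => k * (-5 / 4 - 75 / 4 * k) / ((5 * k - 1) * (k + 1)))
    summable_exampleCoeff_mul_div (by simp) (fun k => ?_) (fun k => ?_)
  · rcases k with _ | k
    · norm_num
    · have hk : (0 : ℝ) ≤ k := k.cast_nonneg
      have hp : 0 < (5 * ((k + 1 : ℕ) : ℝ) - 1) * ((k + 1 : ℕ) + 1) := by push_cast; nlinarith
      rw [abs_div, abs_of_pos hp, div_le_iff₀ hp, abs_le]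
      push_cast
      constructor <;> nlinarith
  · have h5 := five_mul_sub_one_ne_zero k
    have h6 : 5 * ((k : ℝ) + 1) - 1 = 5 * k + 4 := by ring
    rw [exampleCoeff_succ, exampleCoeff, binom_succ]
    simp only [Nat.cast_add, Nat.cast_one, h6]
    generalize hD : 5 * (k : ℝ) - 1 = D at h5
    have hk : (k : ℝ) = (D + 1) / 5 := by linarith
    field_simp
    rw [hk]
    ring

/-! ### Reduction of the Gamma values to `Γ(2/5)` and `Γ(6/5)` -/

theorem gamma_eleven_fifths : Real.Gamma (11 / 5) = 6 / 5 * Real.Gamma (6 / 5) := by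
  rw [← Real.Gamma_add_one (by norm_num)]; norm_num

theorem gamma_sixteen_fifths : Real.Gamma (16 / 5) = 66 / 25 * Real.Gamma (6 / 5) := by
  rw [show (16 / 5 : ℝ) = 11 / 5 + 1 by norm_num, Real.Gamma_add_one (by norm_num),
    gamma_eleven_fifths]
  ring

theorem gamma_seven_fifths : Real.Gamma (7 / 5) = 2 / 5 * Real.Gamma (2 / 5) := by
  rw [← Real.Gamma_add_one (by norm_num)]; norm_num

/-! ### Taylor coefficients of the example -/

theorem differentiableOn_one_sub_cpow (a : ℂ) :
    DifferentiableOn ℂ (fun z : ℂ => (1 - z) ^ a) (Metric.ball 0 1) := by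
  intro z hz
  have hz' : ‖z‖ < 1 := by simpa using hz
  refine (DifferentiableAt.cpow_const (by fun_prop) ?_).differentiableWithinAt
  rw [sub_eq_add_neg]
  exact Complex.mem_slitPlane_of_norm_lt_one (by simpa using hz')

theorem one_sub_ne_zero {z : ℂ} (hz : z ∈ Metric.ball (0 : ℂ) 1) : 1 - z ≠ 0 := by
  rintro h
  have : z = 1 := by linear_combination -h
  simp [this] at hz

theorem bergmanExample_eq :
    bergmanExample = fun z => (1 + z) * (1 - z) ^ (-(4 / 5 : ℂ)) := by
  ext z
  rw [bergmanExample, Complex.cpow_neg, div_eq_mul_inv]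

theorem differentiableOn_bergmanExample :
    DifferentiableOn ℂ bergmanExample (Metric.ball 0 1) := by
  rw [bergmanExample_eq]
  exact (by fun_prop : DifferentiableOn ℂ (fun z : ℂ => 1 + z) _).mul
    (differentiableOn_one_sub_cpow _)

theorem analyticAt_bergmanExample : AnalyticAt ℂ bergmanExample 0 :=
  differentiableOn_bergmanExample.analyticAt (Metric.ball_mem_nhds 0 one_pos)

theorem coeff_one_sub_cpow_neg_four_fifths (k : ℕ) :
    coeff (fun z : ℂ => (1 - z) ^ (-(4 / 5 : ℂ))) k = binom k := by
  rw [coeff_one_sub_cpow, binom, ofReal_multichoose]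
  norm_num

theorem coeff_bergmanExample (k : ℕ) : coeff bergmanExample k = exampleCoeff k := by
  set g : ℂ → ℂ := fun z => (1 - z) ^ (-(4 / 5 : ℂ)) with hg
  have hga : AnalyticAt ℂ g 0 := (hasFPowerSeriesAt_one_sub_cpow _).analyticAt
  have h : bergmanExample = g + fun z => z * g z := by
    rw [bergmanExample_eq]; ext z; simp only [Pi.add_apply, hg]; ring
  rw [h, coeff_add hga (g := fun z => z * g z) (analyticAt_id.mul hga),
    coeff_one_sub_cpow_neg_four_fifths]
  rcases k with _ | k
  · rw [coeff_mul_id_zero hga, binom_zero, exampleCoeff_zero, add_zero]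
  · rw [coeff_mul_id_succ hga, coeff_one_sub_cpow_neg_four_fifths, exampleCoeff_succ_eq_add]
    push_cast; rfl

theorem norm_coeff_bergmanExample_sq (k : ℕ) :
    ‖coeff bergmanExample k‖ ^ 2 = exampleCoeff k ^ 2 := by
  rw [coeff_bergmanExample, Complex.norm_real, Real.norm_eq_abs, sq_abs]

theorem bergmanExample_mem : bergmanExample ∈ bergman :=
  mem_bergman_iff.2 ⟨differentiableOn_bergmanExample, by
    simpa only [norm_coeff_bergmanExample_sq] using summable_exampleCoeff_sq_div⟩

/-- `bergmanExample` as an element of the Bergman space. -/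
def exampleVec : bergman := ⟨bergmanExample, bergmanExample_mem⟩

theorem norm_toSeq_shift_exampleVec_sq : ‖toSeq (shift exampleVec)‖ ^ 2 =
    595 / 242 * (Real.Gamma (2 / 5) / Real.Gamma (6 / 5) ^ 2) := by
  rw [norm_toSeq_shift_sq, ← tsum_exampleCoeff_sq_div]
  exact tsum_congr fun k => by rw [exampleVec, norm_coeff_bergmanExample_sq]

theorem inner_toSeq_shift_exampleVec : inner ℂ (toSeq (shift exampleVec)) (toSeq exampleVec) =
    ((5 / 2 * (Real.Gamma (2 / 5) / Real.Gamma (6 / 5) ^ 2) : ℝ) : ℂ) := by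
  rw [← dinner_eq_inner_toSeq, dinner, ← tsum_exampleCoeff_mul_div]
  have hc (k : ℕ) : coeff (shift exampleVec).1 (k + 1) = exampleCoeff k := by
    rw [← coeff_bergmanExample]
    exact coeff_mul_id_succ analyticAt_bergmanExample k
  have hc0 : coeff (shift exampleVec).1 0 = 0 := coeff_mul_id_zero analyticAt_bergmanExample
  have hterm (k : ℕ) : (((((k + 1 : ℕ) : ℝ) + 1) ^ (-1 : ℝ) : ℝ) : ℂ) *
      coeff exampleVec.1 (k + 1) * conj (coeff (shift exampleVec).1 (k + 1)) =
      ((exampleCoeff (k + 1) * exampleCoeff k / (k + 2) : ℝ) : ℂ) := by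
    rw [hc, exampleVec, coeff_bergmanExample, Complex.conj_ofReal, Real.rpow_neg_one,
      show ((k + 1 : ℕ) : ℝ) + 1 = k + 2 by push_cast; ring, ← Complex.ofReal_mul,
      ← Complex.ofReal_mul]
    congr 1
    ring
  rw [Complex.ofReal_tsum, ← tsum_congr hterm]
  -- The term of index `0` vanishes since `z f` has no constant term, so the supports correspond
  -- under `k ↦ k + 1`.
  refine (tsum_eq_tsum_of_ne_zero_bij (fun k => k.1 + 1) ?_ ?_ ?_)
  · intro a b h
    exact Subtype.ext (by simpa using h)
  · rintro (_ | k) hk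
    · simp [hc0] at hk
    · exact ⟨⟨k, hk⟩, rfl⟩
  · intro k; rfl

/-! ### Cyclicity -/

/-- The polynomial multiples of `f`, seen in `ℓ²`. -/
def multiples (f : bergman) : Submodule ℂ (lp (fun _ : ℕ => ℂ) 2) :=
  Submodule.span ℂ (Set.range fun j : ℕ => toSeq ((shift ^ j) f))

theorem toSeq_mem_multiples (f : bergman) (j : ℕ) : toSeq ((shift ^ j) f) ∈ multiples f :=
  Submodule.subset_span ⟨j, rfl⟩

theorem exists_mem_span_of_mem_multiples (f : bergman) {x : lp (fun _ : ℕ => ℂ) 2}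
    (hx : x ∈ multiples f) : ∃ h : bergman, toSeq h = x ∧
      h.1 ∈ Submodule.span ℂ (Set.range fun (k : ℕ) (z : ℂ) => z ^ k * f.1 z) := by
  induction hx using Submodule.span_induction with
  | mem x hx =>
    obtain ⟨j, rfl⟩ := hx
    refine ⟨(shift ^ j) f, rfl, Submodule.subset_span ⟨j, ?_⟩⟩
    ext z
    exact (shift_pow_apply j f z).symm
  | zero => exact ⟨0, map_zero _, Submodule.zero_mem _⟩
  | add x y _ _ hx hy =>
    obtain ⟨g, rfl, hg⟩ := hx
    obtain ⟨h, rfl, hh⟩ := hy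
    exact ⟨g + h, map_add _ _ _, Submodule.add_mem _ hg hh⟩
  | smul a x _ hx =>
    obtain ⟨g, rfl, hg⟩ := hx
    exact ⟨a • g, map_smul _ _ _, Submodule.smul_mem _ a hg⟩

/-- The span is invariant under the shift, and a contraction carries this over to the closure. -/
theorem toSeq_shift_mem_closure_multiples {f g : bergman}
    (hg : toSeq g ∈ (multiples f).topologicalClosure) :
    toSeq (shift g) ∈ (multiples f).topologicalClosure := by
  have hg' := Metric.mem_closure_iff.1 hg
  refine Metric.mem_closure_iff.2 fun ε hε => ?_
  obtain ⟨x, hx, hxε⟩ := hg' ε hε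
  suffices ∃ h : bergman, toSeq h = x ∧ toSeq (shift h) ∈ multiples f by
    obtain ⟨h, rfl, hh⟩ := this
    refine ⟨_, hh, lt_of_le_of_lt ?_ hxε⟩
    rw [dist_eq_norm, dist_eq_norm, ← map_sub, ← map_sub, ← map_sub]
    exact norm_toSeq_shift_le _
  clear hxε
  replace hx : x ∈ multiples f := hx
  induction hx using Submodule.span_induction with
  | mem x hx =>
    obtain ⟨j, rfl⟩ := hx
    refine ⟨(shift ^ j) f, rfl, ?_⟩
    rw [← Module.End.mul_apply, ← pow_succ']
    exact toSeq_mem_multiples f _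
  | zero => exact ⟨0, map_zero _, by simp⟩
  | add x y _ _ ihx ihy =>
    obtain ⟨g, rfl, hg⟩ := ihx
    obtain ⟨h, rfl, hh⟩ := ihy
    exact ⟨g + h, map_add _ _ _, by rw [map_add, map_add]; exact add_mem hg hh⟩
  | smul a x _ ih =>
    obtain ⟨g, rfl, hg⟩ := ih
    exact ⟨a • g, map_smul _ _ _, by rw [map_smul, map_smul]; exact Submodule.smul_mem _ a hg⟩

theorem toSeq_shift_pow_mem_closure_multiples {f g : bergman}
    (hg : toSeq g ∈ (multiples f).topologicalClosure) (j : ℕ) :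
    toSeq ((shift ^ j) g) ∈ (multiples f).topologicalClosure := by
  induction j with
  | zero => simpa using hg
  | succ j ih =>
    rw [pow_succ', Module.End.mul_apply]
    exact toSeq_shift_mem_closure_multiples ih

theorem one_mem_bergman : (fun _ => 1 : ℂ → ℂ) ∈ bergman := by
  refine mem_bergman_iff.2 ⟨differentiableOn_const 1, ?_⟩
  refine summable_of_ne_finset_zero (s := {0}) fun k hk => ?_
  have : coeff (fun _ => 1) k = 0 := by simpa [Finset.mem_singleton.not.1 hk] using coeff_pow 0 k
  simp [this]

/-- The constant function `1` as an element of the Bergman space. -/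
def oneVec : bergman := ⟨fun _ => 1, one_mem_bergman⟩

theorem coeff_oneVec (k : ℕ) : coeff oneVec.1 k = if k = 0 then 1 else 0 := by
  simpa [oneVec] using coeff_pow 0 k

theorem coeff_shift_pow_oneVec (j k : ℕ) :
    coeff ((shift ^ j) oneVec).1 k = if k = j then 1 else 0 := by
  rw [← coeff_pow]
  congr 1
  ext z
  simp [shift_pow_apply, oneVec]

theorem toSeq_shift_pow_oneVec (j : ℕ) :
    toSeq ((shift ^ j) oneVec) = lp.single 2 j ((√(j + 1 : ℝ) : ℂ))⁻¹ := by
  ext k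
  rw [toSeq_apply, coeff_shift_pow_oneVec, lp.single_apply, Pi.single_apply]
  split_ifs with h
  · rw [h, one_div]
  · simp

/-- Polynomials are dense, so that a vector whose polynomial multiples approximate `1` is cyclic. -/
theorem closure_multiples_eq_top {f : bergman}
    (h : toSeq oneVec ∈ (multiples f).topologicalClosure) :
    (multiples f).topologicalClosure = ⊤ := by
  refine Submodule.eq_top_iff'.2 fun x => ?_
  refine (Submodule.isClosed_topologicalClosure _).mem_of_tendsto
    (lp.hasSum_single (by norm_num) x) (.of_forall fun s => Submodule.sum_mem _ fun j _ => ?_)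
  -- The monomial `z^j` is the `j`-th unit vector divided by `√(j + 1)`; the factor undoes this.
  have := Submodule.smul_mem _ (x j * (√(j + 1 : ℝ) : ℂ))
    (toSeq_shift_pow_mem_closure_multiples h j)
  rw [toSeq_shift_pow_oneVec, ← lp.single_smul, smul_eq_mul, mul_assoc, mul_inv_cancel₀, mul_one]
    at this
  · exact this
  · exact Complex.ofReal_ne_zero.2 (Real.sqrt_pos.2 (by positivity)).ne'

theorem isCyclic_of_closure_multiples_eq_top {f : bergman}
    (h : (multiples f).topologicalClosure = ⊤) : IsCyclic (-1) f.1 := by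
  refine ⟨f.2, Set.Subset.antisymm (fun g hg => hg.1) fun g hg => ⟨hg, fun ε hε => ?_⟩⟩
  have hm : toSeq ⟨g, hg⟩ ∈ (multiples f).topologicalClosure := h ▸ Submodule.mem_top
  obtain ⟨x, hx, hxε⟩ := Metric.mem_closure_iff.1 hm ε hε
  obtain ⟨u, rfl, hu⟩ := exists_mem_span_of_mem_multiples f hx
  refine ⟨u.1, hu, ?_⟩
  rw [dist_eq_norm, ← map_sub, ← dnorm_eq_norm_toSeq] at hxε
  exact hxε

/-- If `1 + z` is approximated by multiples of `f`, then so is `1`, since `1 - (-z)^j` is a multiple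
of `1 + z` and `z^j` tends to zero in the Bergman space. -/
theorem one_mem_closure_multiples {f : bergman}
    (h : toSeq (oneVec + shift oneVec) ∈ (multiples f).topologicalClosure) :
    toSeq oneVec ∈ (multiples f).topologicalClosure := by
  have hj (j : ℕ) : toSeq oneVec - (-1 : ℂ) ^ j • toSeq ((shift ^ j) oneVec) ∈
      (multiples f).topologicalClosure := by
    induction j with
    | zero => simp
    | succ j ih =>
      -- `1 - (-z)^(j + 1) = (1 - (-z)^j) + (-z)^j (1 + z)`.
      have h' := Submodule.smul_mem _ ((-1 : ℂ) ^ j) (toSeq_shift_pow_mem_closure_multiples h j)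
      have h2 : (shift ^ j) (shift oneVec) = (shift ^ (j + 1)) oneVec := by
        rw [pow_succ, Module.End.mul_apply]
      rw [map_add, map_add, h2] at h'
      convert add_mem ih h' using 1
      rw [pow_succ, smul_add, mul_neg_one, neg_smul]
      abel
  refine (Submodule.isClosed_topologicalClosure _).mem_of_tendsto (b := atTop) ?_ (.of_forall hj)
  rw [tendsto_iff_norm_sub_tendsto_zero]
  have hnorm (j : ℕ) : ‖toSeq oneVec - (-1 : ℂ) ^ j • toSeq ((shift ^ j) oneVec) - toSeq oneVec‖ =
      √(1 / ((j : ℝ) + 1)) := by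
    rw [sub_sub_cancel_left, norm_neg, norm_smul, norm_pow, norm_neg, norm_one, one_pow, one_mul,
      toSeq_shift_pow_oneVec, lp.norm_single (by norm_num), norm_inv, Complex.norm_real,
      Real.norm_of_nonneg (Real.sqrt_nonneg _), one_div, Real.sqrt_inv]
  simp only [hnorm]
  simpa using (tendsto_one_div_add_atTop_nhds_zero_nat (𝕜 := ℝ)).sqrt

/-- A function with absolutely summable Taylor coefficients acts by multiplication: its product with
`f` is approximated by polynomial multiples of `f`. -/
theorem toSeq_mem_closure_multiples_of_summable {f g : bergman} {w : ℂ → ℂ}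
    (hw : AnalyticAt ℂ w 0) (hs : Summable fun k => ‖coeff w k‖)
    (hg : g.1 =ᶠ[𝓝 0] fun z => w z * f.1 z) :
    toSeq g ∈ (multiples f).topologicalClosure := by
  have hsum : Summable fun k => coeff w k • toSeq ((shift ^ k) f) := by
    refine Summable.of_norm_bounded (hs.mul_right ‖toSeq f‖) fun k => ?_
    rw [norm_smul]
    gcongr
    exact norm_toSeq_shift_pow_le k f
  have heq : ∑' k, coeff w k • toSeq ((shift ^ k) f) = toSeq g := by
    -- Coordinatewise the series is a Cauchy product, finite because `z^i f` has no coefficient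
    -- below degree `i`.
    ext m
    have h1 := (lp.evalCLM ℂ (fun _ : ℕ => ℂ) 2 m).map_tsum hsum
    refine h1.trans ?_
    have h2 : coeff g.1 m = ∑ i ∈ Finset.range (m + 1), coeff w i * coeff f.1 (m - i) := by
      rw [← coeff_mul hw (analyticAt_of_mem_bergman f.2), coeff, coeff, hg.iteratedDeriv_eq]
    rw [toSeq_apply, h2, Finset.sum_div, tsum_eq_sum (s := Finset.range (m + 1))]
    · refine Finset.sum_congr rfl fun i hi => ?_
      have hi : i ≤ m := by simpa [Nat.lt_succ_iff] using hi
      change coeff w i * (toSeq ((shift ^ i) f) m) = _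
      rw [toSeq_apply, coeff_shift_pow, if_pos hi, mul_div_assoc]
    · intro i hi
      have hi : ¬ i ≤ m := by simpa [Nat.lt_succ_iff] using hi
      change coeff w i * (toSeq ((shift ^ i) f) m) = 0
      rw [toSeq_apply, coeff_shift_pow, if_neg hi, zero_div, mul_zero]
  rw [← heq]
  exact (Submodule.isClosed_topologicalClosure _).mem_of_tendsto hsum.hasSum
    (.of_forall fun s => Submodule.sum_mem _ fun k _ => Submodule.smul_mem _ _
      (Submodule.le_topologicalClosure _ (toSeq_mem_multiples f k)))

theorem multichoose_neg_four_fifths_succ_neg (k : ℕ) :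
    Ring.multichoose (-(4 / 5) : ℝ) (k + 1) < 0 := by
  induction k with
  | zero => rw [multichoose_succ]; norm_num
  | succ k ih =>
    rw [multichoose_succ]
    refine div_neg_of_neg_of_pos (mul_neg_of_neg_of_pos ih ?_) (by positivity)
    push_cast
    have : (0 : ℝ) ≤ k := k.cast_nonneg
    linarith

/-- Partial sums are the coefficients of `(1 - z)^(4/5) / (1 - z) = (1 - z)^(-1/5)`, whence the
closed form. -/
theorem sum_multichoose_neg_four_fifths (n : ℕ) :
    ∑ k ∈ Finset.range (n + 1), Ring.multichoose (-(4 / 5) : ℝ) k =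
      -(5 / 4) * (n + 1) * Ring.multichoose (-(4 / 5) : ℝ) (n + 1) := by
  induction n with
  | zero => simp [multichoose_succ]
  | succ n ih =>
    rw [Finset.sum_range_succ, ih, multichoose_succ _ (n + 1)]
    push_cast
    field_simp
    ring

/-- All coefficients after the first, which is `1`, are negative, while the partial sums are
positive; so the absolute values after the first sum to at most `1`. -/
theorem summable_abs_multichoose_neg_four_fifths :
    Summable fun k => |Ring.multichoose (-(4 / 5) : ℝ) k| := by
  rw [← summable_nat_add_iff 1]
  refine summable_of_sum_range_le (c := 1) (fun k => abs_nonneg _) fun n => ?_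
  have h1 : ∑ k ∈ Finset.range n, |Ring.multichoose (-(4 / 5) : ℝ) (k + 1)| =
      1 - ∑ k ∈ Finset.range (n + 1), Ring.multichoose (-(4 / 5) : ℝ) k := by
    rw [Finset.sum_range_succ']
    simp [abs_of_neg (multichoose_neg_four_fifths_succ_neg _)]
  rw [h1, sum_multichoose_neg_four_fifths]
  have := multichoose_neg_four_fifths_succ_neg n
  have hn : (0 : ℝ) < 5 / 4 * (n + 1) := by positivity
  nlinarith

theorem isCyclic_bergmanExample : IsCyclic (-1) bergmanExample := by
  refine isCyclic_of_closure_multiples_eq_top (f := exampleVec)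
    (closure_multiples_eq_top (one_mem_closure_multiples ?_))
  have hcoeff (k : ℕ) : coeff (fun z : ℂ => (1 - z) ^ (-(-(4 / 5) : ℂ))) k =
      (Ring.multichoose (-(4 / 5) : ℝ) k : ℝ) := by
    rw [coeff_one_sub_cpow, ofReal_multichoose]
    norm_num
  refine toSeq_mem_closure_multiples_of_summable
    (hasFPowerSeriesAt_one_sub_cpow (-(4 / 5))).analyticAt ?_ ?_
  · simpa only [hcoeff, Complex.norm_real, Real.norm_eq_abs] using
      summable_abs_multichoose_neg_four_fifths
  · filter_upwards [Metric.ball_mem_nhds (0 : ℂ) one_pos] with z hz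
    have h : (1 - z) ^ (4 / 5 : ℂ) ≠ 0 := by
      rw [Complex.cpow_ne_zero_iff]; exact Or.inl (one_sub_ne_zero hz)
    change 1 + z * 1 = (1 - z) ^ (-(-(4 / 5) : ℂ)) * bergmanExample z
    rw [neg_neg, bergmanExample]
    field_simp

/-! ### Optimal approximants of order one -/

theorem eval_mul_sub_one_eq (f : bergman) (p : Polynomial ℂ) (hp : p.natDegree ≤ 1) :
    (fun z => p.eval z * f.1 z - 1) = (p.coeff 0 • f + p.coeff 1 • shift f - oneVec).1 := by
  ext z
  conv_lhs => rw [Polynomial.eq_X_add_C_of_natDegree_le_one hp]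
  simp [shift_apply, oneVec]
  ring

theorem dnorm_mul_sub_one (f : bergman) {p : Polynomial ℂ} (hp : p.natDegree ≤ 1) :
    dnorm (-1) (fun z => p.eval z * f.1 z - 1) =
      ‖p.coeff 0 • toSeq f + p.coeff 1 • toSeq (shift f) - toSeq oneVec‖ := by
  rw [eval_mul_sub_one_eq f p hp, dnorm_eq_norm_toSeq]
  simp only [map_sub, map_add, map_smul]

theorem inner_toSeq_oneVec (f : bergman) :
    inner ℂ (toSeq f) (toSeq oneVec) = conj (coeff f.1 0) := by
  rw [← dinner_eq_inner_toSeq, dinner, tsum_eq_single 0]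
  · simp [coeff_oneVec]
  · intro k hk
    simp [coeff_oneVec, hk]

/-- Pythagoras: the residual at `(a, b)` is orthogonal to the span of `u` and `v`. -/
theorem norm_smul_add_smul_sub_sq {E : Type*} [NormedAddCommGroup E] [InnerProductSpace ℂ E]
    {u v e : E} {a b : ℂ}
    (hu : inner ℂ (a • u + b • v - e) u = 0) (hv : inner ℂ (a • u + b • v - e) v = 0) (c d : ℂ) :
    ‖c • u + d • v - e‖ ^ 2 = ‖a • u + b • v - e‖ ^ 2 + ‖(c - a) • u + (d - b) • v‖ ^ 2 := by
  have h : c • u + d • v - e = (a • u + b • v - e) + ((c - a) • u + (d - b) • v) := by module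
  have h0 : inner ℂ (a • u + b • v - e) ((c - a) • u + (d - b) • v) = 0 := by
    rw [inner_add_right, inner_smul_right, inner_smul_right, hu, hv]; simp
  rw [h]
  have := norm_add_sq_eq_norm_sq_add_norm_sq_of_inner_eq_zero _ _ h0
  simpa only [sq] using this

/-- The best approximation of a vector from the span of two vectors, in terms of the normal
equations. -/
theorem exists_normal_equations {E : Type*} [NormedAddCommGroup E] [InnerProductSpace ℂ E]
    (u v e : E) : ∃ a b : ℂ,
      inner ℂ (a • u + b • v - e) u = 0 ∧ inner ℂ (a • u + b • v - e) v = 0 := by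
  set K : Submodule ℂ E := Submodule.span ℂ {u, v} with hK
  have : FiniteDimensional ℂ K := FiniteDimensional.span_of_finite ℂ (by simp)
  obtain ⟨a, b, hab⟩ := Submodule.mem_span_pair.1 (K.starProjection_apply_mem e)
  have horth : K.starProjection e - e ∈ Kᗮ := by
    rw [← neg_sub]; exact neg_mem (K.sub_starProjection_mem_orthogonal e)
  rw [← hab] at horth
  exact ⟨a, b, Submodule.inner_left_of_mem_orthogonal (Submodule.subset_span (by simp)) horth,
    Submodule.inner_left_of_mem_orthogonal (Submodule.subset_span (by simp)) horth⟩

/-- Since `z f` vanishes at `0` and `f` does not, degree `0` forces `c = 0`, then degree `1` forces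
`d = 0`. This independence makes the minimiser unique. -/
theorem eq_zero_of_smul_add_smul_shift_eq_zero {f : bergman} (hf : coeff f.1 0 ≠ 0) {c d : ℂ}
    (h : c • toSeq f + d • toSeq (shift f) = 0) : c = 0 ∧ d = 0 := by
  have ha := analyticAt_of_mem_bergman f.2
  have h0 : coeff (shift f).1 0 = 0 := coeff_mul_id_zero ha
  have h1 : coeff (shift f).1 1 = coeff f.1 0 := coeff_mul_id_succ ha 0
  have e (k : ℕ) : (c • toSeq f + d • toSeq (shift f)) k = 0 := by rw [h]; rfl
  have e0 := e 0
  have e1 := e 1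
  rw [lp.coeFn_add, lp.coeFn_smul, lp.coeFn_smul] at e0 e1
  simp only [Pi.add_apply, Pi.smul_apply, smul_eq_mul, toSeq_apply, h0, h1] at e0 e1
  have hc : c = 0 := by simpa [hf] using e0
  refine ⟨hc, ?_⟩
  rw [hc] at e1
  have h2 : (√(((1 : ℕ) : ℝ) + 1) : ℂ) ≠ 0 :=
    Complex.ofReal_ne_zero.2 (Real.sqrt_pos.2 (by positivity)).ne'
  simpa [hf, -Nat.cast_one, h2] using e1

/-- If `f(0) ≠ 0` and `⟨f, z f⟩ ≠ 0`, there is exactly one optimal approximant of order `1` to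
`1 / f`, and its only zero is `‖z f‖² / ⟨f, z f⟩`. -/
theorem exists_unique_optimalApproximant (f : bergman) (hf : coeff f.1 0 ≠ 0)
    (hne : inner ℂ (toSeq (shift f)) (toSeq f) ≠ 0) :
    ∃ p : Polynomial ℂ, (∀ q : Polynomial ℂ, IsOptimalApproximant (-1) f.1 1 q ↔ q = p) ∧
      {z : ℂ | p.eval z = 0} =
        {(‖toSeq (shift f)‖ : ℂ) ^ 2 / inner ℂ (toSeq (shift f)) (toSeq f)} := by
  obtain ⟨a, b, h1, h2⟩ := exists_normal_equations (toSeq f) (toSeq (shift f)) (toSeq oneVec)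
  set p : Polynomial ℂ := Polynomial.C b * Polynomial.X + Polynomial.C a with hp
  have hdeg : p.natDegree ≤ 1 := Polynomial.natDegree_linear_le
  have hp0 : p.coeff 0 = a := by simp [hp]
  have hp1 : p.coeff 1 = b := by simp [hp]
  have hpyth (q : Polynomial ℂ) (hq : q.natDegree ≤ 1) :
      dnorm (-1) (fun z => q.eval z * f.1 z - 1) ^ 2 =
        dnorm (-1) (fun z => p.eval z * f.1 z - 1) ^ 2 +
        ‖(q.coeff 0 - a) • toSeq f + (q.coeff 1 - b) • toSeq (shift f)‖ ^ 2 := by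
    rw [dnorm_mul_sub_one f hq, dnorm_mul_sub_one f hdeg, hp0, hp1]
    exact norm_smul_add_smul_sub_sq h1 h2 _ _
  have hnonneg (q : ℂ → ℂ) : 0 ≤ dnorm (-1) q := Real.sqrt_nonneg _
  refine ⟨p, fun q => ⟨fun hq => ?_, ?_⟩, ?_⟩
  · have hle := pow_le_pow_left₀ (hnonneg _) (hq.2.2 p hdeg) 2
    rw [hpyth q hq.2.1] at hle
    have hz : ‖(q.coeff 0 - a) • toSeq f + (q.coeff 1 - b) • toSeq (shift f)‖ ^ 2 = 0 :=
      le_antisymm (by linarith) (sq_nonneg _)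
    obtain ⟨hc, hd⟩ := eq_zero_of_smul_add_smul_shift_eq_zero hf (by simpa using hz)
    rw [Polynomial.eq_X_add_C_of_natDegree_le_one hq.2.1, sub_eq_zero.1 hc, sub_eq_zero.1 hd]
  · rintro rfl
    refine ⟨f.2, hdeg, fun q hq => ?_⟩
    rw [← sq_le_sq₀ (hnonneg _) (hnonneg _), hpyth q hq]
    exact le_add_of_nonneg_right (sq_nonneg _)
  · have h2' : a * inner ℂ (toSeq (shift f)) (toSeq f) + b * (‖toSeq (shift f)‖ : ℂ) ^ 2 = 0 := by
      have := inner_eq_zero_symm.1 h2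
      have h0 : coeff (shift f).1 0 = 0 := coeff_mul_id_zero (analyticAt_of_mem_bergman f.2)
      rw [inner_sub_right, inner_add_right, inner_smul_right, inner_smul_right,
        inner_toSeq_oneVec, h0, map_zero, sub_zero, inner_self_eq_norm_sq_to_K] at this
      exact this
    -- With `b = 0` the second normal equation gives `a = 0`, and then the first makes `1`
    -- orthogonal to `f`, against `f(0) ≠ 0`.
    have hb : b ≠ 0 := by
      rintro rfl
      have ha : a = 0 := by simpa [hne] using h2'
      have := inner_eq_zero_symm.1 h1
      rw [ha, zero_smul, zero_smul, add_zero, zero_sub, inner_neg_right, inner_toSeq_oneVec] at this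
      simp [hf] at this
    have hs : (‖toSeq (shift f)‖ : ℂ) ^ 2 = -a * inner ℂ (toSeq (shift f)) (toSeq f) / b := by
      field_simp
      linear_combination h2'
    ext z
    simp only [hp, Set.mem_ofPred_eq, Set.mem_singleton_iff, Polynomial.eval_add,
      Polynomial.eval_mul, Polynomial.eval_C, Polynomial.eval_X, hs]
    rw [div_right_comm, mul_div_cancel_right₀ _ hne, eq_div_iff hb]
    constructor <;> intro h <;> linear_combination h

end DirichletType

end

theorem mainTheorem7 :
    DirichletType.IsCyclic (-1) DirichletType.bergmanExample ∧
    (fun z => z * DirichletType.bergmanExample z) ∈ DirichletType.space (-1) ∧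
    DirichletType.dnorm (-1) (fun z => z * DirichletType.bergmanExample z) ^ 2 =
      2142 / 125 * (Real.Gamma (2 / 5) / Real.Gamma (16 / 5) ^ 2) ∧
    DirichletType.dinner (-1) DirichletType.bergmanExample
        (fun z => z * DirichletType.bergmanExample z) =
      ((9 * (Real.Gamma (7 / 5) / Real.Gamma (11 / 5) ^ 2) : ℝ) : ℂ) ∧
    (∃ p : Polynomial ℂ,
      (∀ q : Polynomial ℂ,
        DirichletType.IsOptimalApproximant (-1) DirichletType.bergmanExample 1 q ↔ q = p) ∧
      {z : ℂ | p.eval z = 0} = {119 / 121}) ∧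
    (119 / 121 : ℂ) ∈ Metric.ball (0 : ℂ) 1 ∧
    DirichletType.bergmanExample (119 / 121) ≠ 0 := by
  open DirichletType in
  have hG : 0 < Real.Gamma (2 / 5) / Real.Gamma (6 / 5) ^ 2 :=
    div_pos (Real.Gamma_pos_of_pos (by norm_num))
      (pow_pos (Real.Gamma_pos_of_pos (by norm_num)) 2)
  have hball : (119 / 121 : ℂ) ∈ Metric.ball (0 : ℂ) 1 := by
    rw [mem_ball_zero_iff]; norm_num
  refine ⟨isCyclic_bergmanExample, id_mul_mem_bergman bergmanExample_mem, ?_, ?_, ?_, hball, ?_⟩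
  · refine (congrArg (· ^ 2) (dnorm_eq_norm_toSeq (shift exampleVec))).trans ?_
    refine norm_toSeq_shift_exampleVec_sq.trans ?_
    rw [gamma_sixteen_fifths]
    field_simp
    norm_num
  · refine (dinner_eq_inner_toSeq exampleVec (shift exampleVec)).trans ?_
    rw [inner_toSeq_shift_exampleVec, gamma_seven_fifths, gamma_eleven_fifths]
    congr 1
    field_simp
    norm_num
  · have hne : inner ℂ (toSeq (shift exampleVec)) (toSeq exampleVec) ≠ 0 := by
      rw [inner_toSeq_shift_exampleVec]
      exact Complex.ofReal_ne_zero.2 (by positivity)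
    have h0 : coeff exampleVec.1 0 ≠ 0 := by
      rw [exampleVec, coeff_bergmanExample, exampleCoeff_zero]; simp
    obtain ⟨p, hp, hz⟩ := exists_unique_optimalApproximant exampleVec h0 hne
    refine ⟨p, hp, hz.trans ?_⟩
    -- The Gamma factor cancels, leaving `(595/242) / (5/2) = 119/121`.
    rw [inner_toSeq_shift_exampleVec, ← Complex.ofReal_pow, norm_toSeq_shift_exampleVec_sq,
      ← Complex.ofReal_div, mul_div_mul_right _ _ hG.ne']
    norm_num
  · rw [bergmanExample]
    refine div_ne_zero (by norm_num) ?_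
    rw [Complex.cpow_ne_zero_iff]
    exact Or.inl (one_sub_ne_zero hball)
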